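/- Let $d\ge 2$ be an integer. There is a constant $C>0$ depending only on $d$ such that the following holds. Let $p$ be a prime, let $H,N$ be positive integers with $H,N\le p$, and let $s$ be a positive integer with $s<d$. Let $A_1,\dots,A_d$ be integers and let $$\mathfrak B=[A_1+1,A_1+H]\times\cdots\times[A_d+1,A_d+H]\subseteq\mathbb F_p^d$$ be the corresponding cube (the integers in each interval being reduced modulo $p$), so that $\#\mathfrak B=H^d$. For complex numbers $\gamma_1,\dots,\gamma_N$ with $|\gamma_n|\le 1$ and $\mathbf a=(a_1,\dots,a_d)\in\mathbb F_p^d$, put $$S(\mathbf a,\boldsymbol\gamma;N)=\sum_{n=1}^N\gamma_n\exp\!\left(\frac{2\pi i}{p}(a_1n+a_2n^2+\cdots+a_dn^d)\right).$$ Then $$\frac1{H^d}\sum_{\mathbf a\in\mathfrak B}|S(\mathbf a,\boldsymbol\gamma;N)|^{2s}\le C\Big(\min\left\{pH^{-1}N^s,\;p^{1/2}H^{-1/2}\left(N^s+N^{2s-d/2}\right)\right\}+\min\left\{(p/H)^dN^{s-1/2},\;(p/H)^{d/2}\left(N^s+N^{2s-d/2}\right)\right\}\Big).$$ In particular, this holds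 for the unweighted sums, that is, with $\gamma_n=1$ for all $n$. -/

import Mathlib

noncomputable section

/-- The phase `a₁ n + a₂ n² + ⋯ + a_d n^d` in `𝔽_p`; the coordinate `a i`, `i : Fin d`, is `a_{i+1}`. -/
def polyPhase {p d : ℕ} (a : Fin d → ZMod p) (n : ℕ) : ZMod p :=
  ∑ i : Fin d, a i * (n : ZMod p) ^ ((i : ℕ) + 1)

/-- `S(a; N) = ∑_{n=1}^N e_p(a₁ n + ⋯ + a_d n^d)`. Mathlib's `ZMod.stdAddChar` is the map
`z ↦ exp (2 π i z / p)` on `ZMod p`. -/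
def ratExpSum {p d : ℕ} [NeZero p] (a : Fin d → ZMod p) (N : ℕ) : ℂ :=
  ∑ n ∈ Finset.Icc 1 N, ZMod.stdAddChar (polyPhase a n)

/-- `S(a, γ; N) = ∑_{n=1}^N γ_n e_p(a₁ n + ⋯ + a_d n^d)`. -/
def ratExpSumWeighted {p d : ℕ} [NeZero p] (a : Fin d → ZMod p) (γ : ℕ → ℂ) (N : ℕ) : ℂ :=
  ∑ n ∈ Finset.Icc 1 N, γ n * ZMod.stdAddChar (polyPhase a n)

/-- The restricted average `M_{d,k}(𝔘; N) = (1 / #𝔘) ∑_{a ∈ 𝔘} |S(a; N)|^k`. -/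
def restrictedMoment {p d : ℕ} [NeZero p] (k : ℕ) (U : Finset (Fin d → ZMod p)) (N : ℕ) : ℝ :=
  (1 / (U.card : ℝ)) * ∑ a ∈ U, ‖ratExpSum a N‖ ^ k

/-- The restricted average `M_{d,k}(𝔘, γ; N) = (1 / #𝔘) ∑_{a ∈ 𝔘} |S(a, γ; N)|^k`. -/
def restrictedMomentWeighted {p d : ℕ} [NeZero p] (k : ℕ) (U : Finset (Fin d → ZMod p))
    (γ : ℕ → ℂ) (N : ℕ) : ℝ :=
  (1 / (U.card : ℝ)) * ∑ a ∈ U, ‖ratExpSumWeighted a γ N‖ ^ k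

/-- The cube `[A₁ + 1, A₁ + H] × ⋯ × [A_d + 1, A_d + H]` in `𝔽_p^d`, where `A₁, …, A_d` are
integers and the integers in the intervals are reduced modulo `p`. -/
def cube (p : ℕ) {d : ℕ} (A : Fin d → ℤ) (H : ℕ) : Finset (Fin d → ZMod p) :=
  Fintype.piFinset fun i =>
    (Finset.Icc (A i + 1) (A i + (H : ℤ))).image (fun m : ℤ => (m : ZMod p))

/-- `min{(p/H) N^s, (p/H)^{1/2} (N^s + N^{2s-d/2})}
  + min{(p/H)^d N^{s-1/2}, (p/H)^{d/2} (N^s + N^{2s-d/2})}`, with real exponents. -/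
def smallBoxBound (p d s H N : ℕ) : ℝ :=
  min ((p : ℝ) * (H : ℝ)⁻¹ * (N : ℝ) ^ (s : ℝ))
      ((p : ℝ) ^ (1 / 2 : ℝ) * (H : ℝ) ^ (-(1 / 2) : ℝ) *
        ((N : ℝ) ^ (s : ℝ) + (N : ℝ) ^ (2 * (s : ℝ) - (d : ℝ) / 2))) +
  min (((p : ℝ) / (H : ℝ)) ^ (d : ℝ) * (N : ℝ) ^ ((s : ℝ) - 1 / 2))
      (((p : ℝ) / (H : ℝ)) ^ ((d : ℝ) / 2) *
        ((N : ℝ) ^ (s : ℝ) + (N : ℝ) ^ (2 * (s : ℝ) - (d : ℝ) / 2)))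

end

/-! As p/H ≥ 1, both entries of the first minimum are at least N^s, so it suffices to bound the
average by a constant times N^s + min(T₃, T₄), where T₃ and T₄ are the entries of the second
minimum. If p ≤ d, everything is bounded in terms of d alone. If p > d, Newton's identities can be
inverted up to degree d, and two bounds are available.

For T₄ (`restrictedMomentWeighted_cube_le_of_parseval`): Cauchy–Schwarz over the cube and completion
to the 4s-th moment over 𝔽_p^d. By Parseval the complete 2k-th moment, k ≤ d, is bounded by counting
pairs of k-tuples with equal power sums, and these are permutations of each other.

For N^s + T₃ (`restrictedMomentWeighted_cube_le_of_congruences`): averaging over translates replaces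
the cutoff by a convolution of two cubes, whose Fourier transform is absolutely summable. Zero
frequency gives N^s; every other frequency h is weighted by the number of (x, y) whose power sum
vectors differ by h. This number is O(N^(s-1)) because s < d (`card_powerSumVec_sub_eq_le`): the
quotient ∏(1 - x_i X)/∏(1 - y_i X) is fixed modulo X^(s+2), while the denominator has degree only s,
so x satisfies a nontrivial multilinear equation. -/

/-! ### Newton's identities for reversed polynomials of multisets. -/

open Polynomial in
/-- The polynomial `∏ (1 - a X)` over the elements `a` of a multiset. -/
noncomputable def revPoly {K : Type*} [Field K] (M : Multiset K) : K[X] :=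
  (M.map fun a => 1 - C a * X).prod

/-- The `j`-th power sum of a multiset. -/
def multisetPsum {K : Type*} [Field K] (M : Multiset K) (j : ℕ) : K :=
  (M.map fun a => a ^ j).sum

section RevPoly

open Polynomial

variable {K : Type*} [Field K]

lemma multisetPsum_add (M N : Multiset K) (j : ℕ) :
    multisetPsum (M + N) j = multisetPsum M j + multisetPsum N j := by
  simp [multisetPsum]

lemma revPoly_add (M N : Multiset K) : revPoly (M + N) = revPoly M * revPoly N := by
  simp [revPoly]

lemma revPoly_cons (a : K) (M : Multiset K) :
    revPoly (a ::ₘ M) = (1 - C a * X) * revPoly M := by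
  simp [revPoly]

lemma revPoly_coeff_zero (M : Multiset K) : (revPoly M).coeff 0 = 1 := by
  induction M using Multiset.induction with
  | empty => simp [revPoly]
  | cons a M ih => simp [revPoly_cons, mul_coeff_zero, ih]

lemma revPoly_eq_reflect (M : Multiset K) :
    revPoly M = reflect (Multiset.card M) (M.map fun a => X - C a).prod := by
  induction M using Multiset.induction with
  | empty => simp [revPoly]
  | cons a M ih =>
    have h1 : reflect 1 (X - C a) = 1 - C a * X := by
      rw [reflect_sub]
      have : reflect 1 (X : K[X]) = 1 := by
        simp
      rw [this, reflect_C]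
      simp
    rw [revPoly_cons, ih, Multiset.map_cons, Multiset.prod_cons, Multiset.card_cons, add_comm,
      reflect_mul _ _ (natDegree_X_sub_C_le a)
        (by rw [natDegree_multiset_prod_X_sub_C_eq_card]), h1]

lemma natDegree_revPoly_le (M : Multiset K) : (revPoly M).natDegree ≤ Multiset.card M := by
  induction M using Multiset.induction with
  | empty => simp [revPoly]
  | cons a M ih =>
    rw [revPoly_cons, Multiset.card_cons, add_comm]
    refine natDegree_mul_le.trans (add_le_add ?_ ih)
    compute_degree

lemma eq_of_revPoly_eq {M N : Multiset K} (hc : Multiset.card M = Multiset.card N)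
    (h : revPoly M = revPoly N) : M = N := by
  rw [revPoly_eq_reflect, revPoly_eq_reflect, hc] at h
  have h' := congrArg (reflect (Multiset.card N)) h
  rw [reflect_reflect, reflect_reflect] at h'
  rw [← roots_multiset_prod_X_sub_C M, h', roots_multiset_prod_X_sub_C]

/-- Newton's identities as a logarithmic derivative: each factor 1 - aX contributes -a/(1 - aX) = -∑
a^(j+1) X^j. -/
lemma derivative_revPoly (M : Multiset K) :
    PowerSeries.derivative K (revPoly M : PowerSeries K) =
      -((revPoly M : PowerSeries K) * PowerSeries.mk fun j => multisetPsum M (j + 1)) := by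
  induction M using Multiset.induction with
  | empty =>
    have : (PowerSeries.mk fun j => multisetPsum (0 : Multiset K) (j + 1)) = 0 := by
      ext; simp [multisetPsum]
    rw [this]
    simp [revPoly]
  | cons a M ih =>
    have h1 : (PowerSeries.mk fun j => multisetPsum (a ::ₘ M) (j + 1)) =
        (PowerSeries.mk fun j => a ^ (j + 1)) + PowerSeries.mk fun j => multisetPsum M (j + 1) := by
      ext; simp [multisetPsum]
    have h2 : (1 - PowerSeries.C a * PowerSeries.X) * (PowerSeries.mk fun j => a ^ (j + 1)) =
        PowerSeries.C a := by
      ext n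
      rw [sub_mul, one_mul, map_sub, mul_assoc, PowerSeries.coeff_C_mul]
      cases n with
      | zero => simp
      | succ n => simp [PowerSeries.coeff_succ_X_mul, pow_succ, mul_comm]
    have h3 : ((revPoly (a ::ₘ M) : K[X]) : PowerSeries K) =
        (1 - PowerSeries.C a * PowerSeries.X) * (revPoly M : PowerSeries K) := by
      rw [revPoly_cons]; simp
    rw [h1, h3, Derivation.leibniz, ih, smul_eq_mul, smul_eq_mul]
    have h4 : PowerSeries.derivative K (1 - PowerSeries.C a * PowerSeries.X) = -PowerSeries.C a := by
      simp [PowerSeries.derivative_C, PowerSeries.derivative_X, Derivation.leibniz]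
    rw [h4]
    linear_combination (revPoly M : PowerSeries K) * h2

lemma succ_mul_coeff_revPoly (M : Multiset K) (k : ℕ) :
    ((k : K) + 1) * (revPoly M).coeff (k + 1) =
      -∑ q ∈ Finset.HasAntidiagonal.antidiagonal k, (revPoly M).coeff q.1 * multisetPsum M (q.2 + 1) := by
  have := congrArg (PowerSeries.coeff k) (derivative_revPoly M)
  rw [PowerSeries.coeff_derivative, map_neg, PowerSeries.coeff_mul] at this
  simp only [Polynomial.coeff_coe, PowerSeries.coeff_mk] at this
  rw [mul_comm, this]

/-- Multisets with the same first `m` power sums have the same first `m` elementary symmetric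
functions, if `m` is less than the characteristic. -/
lemma coeff_revPoly_eq_of_multisetPsum_eq {M N : Multiset K} {m : ℕ}
    (hm : ∀ k : ℕ, 0 < k → k ≤ m → (k : K) ≠ 0)
    (h : ∀ j, 0 < j → j ≤ m → multisetPsum M j = multisetPsum N j) (k : ℕ) (hk : k ≤ m) :
    (revPoly M).coeff k = (revPoly N).coeff k := by
  induction k using Nat.strong_induction_on with
  | _ k ih =>
    cases k with
    | zero => rw [revPoly_coeff_zero, revPoly_coeff_zero]
    | succ k =>
      have h0 : ((k : K) + 1) ≠ 0 := by exact_mod_cast hm (k + 1) (Nat.succ_pos k) hk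
      refine mul_left_cancel₀ h0 ?_
      rw [succ_mul_coeff_revPoly, succ_mul_coeff_revPoly]
      congr 1
      refine Finset.sum_congr rfl fun q hq => ?_
      rw [Finset.HasAntidiagonal.mem_antidiagonal] at hq
      rw [ih q.1 (by omega) (by omega), h (q.2 + 1) (by omega) (by omega)]

lemma eq_of_coeff_revPoly_eq {M N : Multiset K} {s : ℕ}
    (hM : Multiset.card M = s) (hN : Multiset.card N = s)
    (h : ∀ k ≤ s, (revPoly M).coeff k = (revPoly N).coeff k) : M = N := by
  refine eq_of_revPoly_eq (hM.trans hN.symm) ?_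
  ext k
  by_cases hk : k ≤ s
  · exact h k hk
  · rw [coeff_eq_zero_of_natDegree_lt, coeff_eq_zero_of_natDegree_lt]
    · have := natDegree_revPoly_le N
      omega
    · have := natDegree_revPoly_le M
      omega

/-- Let `x₀, y₀` be multisets of size `s` that are not equal. Then there is a power series `G` with a
nonzero coefficient in degrees `1, …, s + 1` such that `coeff (s+1) (revPoly x * G) = 0` for all
`x, y` of size `s` with the same differences of power sums. -/
lemma exists_powerSeries_of_psum_sub {x₀ y₀ : Multiset K} {s : ℕ}
    (hm : ∀ k : ℕ, 0 < k → k ≤ s + 1 → (k : K) ≠ 0)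
    (hx₀ : Multiset.card x₀ = s) (hy₀ : Multiset.card y₀ = s) (hne : x₀ ≠ y₀) :
    ∃ G : PowerSeries K, (∃ k, 1 ≤ k ∧ k ≤ s + 1 ∧ PowerSeries.coeff k G ≠ 0) ∧
      ∀ x y : Multiset K, Multiset.card y = s →
        (∀ j, 0 < j → j ≤ s + 1 →
          multisetPsum x j - multisetPsum y j = multisetPsum x₀ j - multisetPsum y₀ j) →
        PowerSeries.coeff (s + 1) ((revPoly x : PowerSeries K) * G) = 0 := by
  have hA : (revPoly x₀ : PowerSeries K) * (revPoly x₀ : PowerSeries K)⁻¹ = 1 := by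
    refine PowerSeries.mul_inv_cancel _ ?_
    rw [← PowerSeries.coeff_zero_eq_constantCoeff_apply, Polynomial.coeff_coe, revPoly_coeff_zero]
    exact one_ne_zero
  set A : PowerSeries K := (revPoly x₀ : PowerSeries K)
  set B : PowerSeries K := (revPoly y₀ : PowerSeries K) with hB
  -- `G` is the quotient of the reversed polynomials of `y₀` and `x₀`. Were it 1 modulo X^(s+2),
  -- these two polynomials of degree at most s would coincide, against `hne`.
  refine ⟨B * A⁻¹, ?_, ?_⟩
  · by_contra! hcon
    apply hne
    refine eq_of_coeff_revPoly_eq hx₀ hy₀ fun k hk => ?_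
    have hdvd : (PowerSeries.X : PowerSeries K) ^ (s + 2) ∣ B * A⁻¹ - 1 := by
      rw [PowerSeries.X_pow_dvd_iff]
      intro m hm'
      rcases Nat.eq_zero_or_pos m with rfl | hpos
      · rw [map_sub, PowerSeries.coeff_zero_eq_constantCoeff_apply, map_mul]
        have h1 := congrArg PowerSeries.constantCoeff hA
        have hb : PowerSeries.constantCoeff B = 1 := by
          rw [← PowerSeries.coeff_zero_eq_constantCoeff_apply, hB, Polynomial.coeff_coe,
            revPoly_coeff_zero]
        have ha : PowerSeries.constantCoeff A = 1 := by
          rw [← PowerSeries.coeff_zero_eq_constantCoeff_apply, Polynomial.coeff_coe,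
            revPoly_coeff_zero]
        rw [map_mul, ha, one_mul] at h1
        rw [h1, hb]
        simp
      · rw [map_sub, hcon m hpos (by omega), PowerSeries.coeff_one]
        simp [hpos.ne']
    have h2 : (PowerSeries.X : PowerSeries K) ^ (s + 2) ∣ B - A := by
      have := hdvd.mul_left A
      have e : A * (B * A⁻¹ - 1) = B - A := by linear_combination B * hA
      rwa [e] at this
    have h3 := PowerSeries.X_pow_dvd_iff.1 h2 k (by omega)
    rw [map_sub, Polynomial.coeff_coe, Polynomial.coeff_coe, sub_eq_zero] at h3
    exact h3.symm
  · intro x y hy h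
    -- Moving the subtracted power sums across turns equal differences into equal power sums of `x +
    -- y₀` and `y + x₀`.
    have hc : ∀ k ≤ s + 1, (revPoly (x + y₀)).coeff k = (revPoly (y + x₀)).coeff k := by
      refine coeff_revPoly_eq_of_multisetPsum_eq hm fun j h1 h2 => ?_
      rw [multisetPsum_add, multisetPsum_add]
      linear_combination h j h1 h2
    have hdvd : (PowerSeries.X : PowerSeries K) ^ (s + 2) ∣
        (revPoly x : PowerSeries K) * B - (revPoly y : PowerSeries K) * A := by
      rw [PowerSeries.X_pow_dvd_iff]
      intro m hm'
      have := hc m (by omega)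
      rw [← Polynomial.coeff_coe, ← Polynomial.coeff_coe, revPoly_add, revPoly_add,
        Polynomial.coe_mul, Polynomial.coe_mul] at this
      rw [map_sub, this, sub_self]
    have h2 := hdvd.mul_right A⁻¹
    have e : ((revPoly x : PowerSeries K) * B - (revPoly y : PowerSeries K) * A) * A⁻¹ =
        (revPoly x : PowerSeries K) * (B * A⁻¹) - (revPoly y : PowerSeries K) := by
      linear_combination (-(revPoly y : PowerSeries K)) * hA
    rw [e] at h2
    -- Modulo X^(s+2) the product `revPoly x * G` is `revPoly y`, of degree at most s, so its
    -- coefficient in degree s + 1 vanishes.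
    have h3 := PowerSeries.X_pow_dvd_iff.1 h2 (s + 1) (by omega)
    rw [map_sub, Polynomial.coeff_coe, coeff_eq_zero_of_natDegree_lt (p := revPoly y), sub_zero]
      at h3
    · exact h3
    · have := natDegree_revPoly_le y
      omega

end RevPoly
-- Counting solutions of Vinogradov systems over a field.
/-- The multiset of the entries of a tuple. -/
def tupleMultiset {K : Type*} {s : ℕ} (x : Fin s → K) : Multiset K := Finset.univ.val.map x

/-- The point `(x, x², …, x^d)` of the moment curve. -/
def momentCurve {K : Type*} [Field K] (d : ℕ) (x : K) : Fin d → K := fun i => x ^ ((i : ℕ) + 1)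

/-- The vector of the first `d` power sums of a tuple. -/
def powerSumVec {K : Type*} [Field K] (d : ℕ) {s : ℕ} (x : Fin s → K) : Fin d → K :=
  ∑ i, momentCurve d (x i)

section Counting

open Polynomial

variable {K : Type*} [Field K] [DecidableEq K]

lemma card_tupleMultiset {K : Type*} {s : ℕ} (x : Fin s → K) :
    Multiset.card (tupleMultiset x) = s := by
  simp [tupleMultiset]

lemma multisetPsum_tupleMultiset {K : Type*} [Field K] {d s : ℕ} (x : Fin s → K) (i : Fin d) :
    multisetPsum (tupleMultiset x) ((i : ℕ) + 1) = powerSumVec d x i := by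
  simp [multisetPsum, tupleMultiset, powerSumVec, momentCurve, List.sum_ofFn]

lemma multisetPsum_sub_of_powerSumVec_sub {K : Type*} [Field K] {d s t : ℕ} {x y : Fin s → K}
    {x' y' : Fin t → K}
    (h : powerSumVec d x - powerSumVec d y = powerSumVec d x' - powerSumVec d y') (j : ℕ)
    (h0 : 0 < j) (hj : j ≤ d) :
    multisetPsum (tupleMultiset x) j - multisetPsum (tupleMultiset y) j =
      multisetPsum (tupleMultiset x') j - multisetPsum (tupleMultiset y') j := by
  obtain ⟨i, rfl⟩ := Nat.exists_eq_add_of_lt h0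
  have := congrFun h ⟨i, by omega⟩
  simp only [Pi.sub_apply, ← multisetPsum_tupleMultiset] at this
  simpa using this

lemma tupleMultiset_eq_of_powerSumVec_eq {K : Type*} [Field K] {d s : ℕ} (hsd : s ≤ d)
    (hd : ∀ k : ℕ, 0 < k → k ≤ d → (k : K) ≠ 0) {x y : Fin s → K}
    (h : powerSumVec d x = powerSumVec d y) : tupleMultiset x = tupleMultiset y := by
  refine eq_of_coeff_revPoly_eq (card_tupleMultiset x) (card_tupleMultiset y) fun k hk => ?_
  refine coeff_revPoly_eq_of_multisetPsum_eq hd (fun j h0 hj => ?_) k (hk.trans hsd)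
  have := multisetPsum_sub_of_powerSumVec_sub (x := x) (y := y) (x' := x) (y' := x)
    (by rw [h]) j h0 hj
  rw [sub_self, sub_eq_zero] at this
  exact this

lemma card_filter_tupleMultiset_eq_le {K : Type*} [DecidableEq K] {s : ℕ} (T : Finset (Fin s → K)) (M : Multiset K) :
    (T.filter fun x => tupleMultiset x = M).card ≤ s.factorial := by
  rcases (T.filter fun x => tupleMultiset x = M).eq_empty_or_nonempty with h | ⟨x₀, hx₀⟩
  · simp [h]
  · have hl : (List.ofFn x₀).permutations.toFinset.card ≤ s.factorial := by
      refine (List.toFinset_card_le _).trans ?_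
      rw [List.length_permutations, List.length_ofFn]
    refine le_trans (Finset.card_le_card_of_injOn List.ofFn (fun x hx => ?_)
      (List.ofFn_injective.injOn)) hl
    rw [Finset.mem_filter] at hx₀
    have hx' := (Finset.mem_filter.1 hx).2
    rw [Finset.mem_coe, List.mem_toFinset, List.mem_permutations, ← Multiset.coe_eq_coe,
      ← Fin.univ_val_map, ← Fin.univ_val_map]
    exact hx'.trans hx₀.2.symm

lemma card_filter_powerSumVec_eq_le {d s : ℕ} (hsd : s ≤ d)
    (hd : ∀ k : ℕ, 0 < k → k ≤ d → (k : K) ≠ 0) (T : Finset (Fin s → K)) (v : Fin d → K) :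
    (T.filter fun x => powerSumVec d x = v).card ≤ s.factorial := by
  rcases (T.filter fun x => powerSumVec d x = v).eq_empty_or_nonempty with h | ⟨x₀, hx₀⟩
  · simp [h]
  · refine le_trans (Finset.card_le_card fun x hx => ?_)
      (card_filter_tupleMultiset_eq_le T (tupleMultiset x₀))
    rw [Finset.mem_filter] at hx hx₀ ⊢
    exact ⟨hx.1, tupleMultiset_eq_of_powerSumVec_eq hsd hd (hx.2.trans hx₀.2.symm)⟩

/-- If all solutions of `powerSumVec x - powerSumVec y = h` in `T` have `x ∈ T'`, then there are at
most `s! #T'` of them. -/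
lemma card_filter_powerSumVec_sub_le {d s : ℕ} (hsd : s ≤ d)
    (hd : ∀ k : ℕ, 0 < k → k ≤ d → (k : K) ≠ 0) (T T' : Finset (Fin s → K)) (h : Fin d → K)
    (hT' : ∀ q ∈ T ×ˢ T, powerSumVec d q.1 - powerSumVec d q.2 = h → q.1 ∈ T') :
    ((T ×ˢ T).filter fun q => powerSumVec d q.1 - powerSumVec d q.2 = h).card ≤
      s.factorial * T'.card := by
  refine Finset.card_le_mul_card_image_of_maps_to (f := Prod.fst) (fun q hq => ?_) _ fun x hx => ?_
  · rw [Finset.mem_filter] at hq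
    exact hT' q hq.1 hq.2
  · refine le_trans (Finset.card_le_card_of_injOn Prod.snd (fun q hq => ?_) ?_)
      (card_filter_powerSumVec_eq_le hsd hd T (powerSumVec d x - h))
    · simp only [Finset.mem_filter, Finset.mem_product, Finset.coe_filter, Set.mem_ofPred_eq] at hq ⊢
      refine ⟨hq.1.1.2, ?_⟩
      rw [← hq.1.2, hq.2]
      abel
    · intro q hq q' hq' e
      simp only [Finset.mem_filter, Finset.coe_filter, Set.mem_ofPred_eq] at hq hq'
      exact Prod.ext (hq.2.trans hq'.2.symm) e

/-- The condition is linear in each coordinate of `x`, and `hF` makes it nontrivial. Fixing the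
first coordinate c replaces `F` by (1 - cX)`F` and drops one variable; at most one value of c
destroys nontriviality. -/
lemma card_filter_coeff_revPoly_mul_eq_zero_le (Ω : Finset K) (t s : ℕ) (hst : s ≤ t)
    (F : PowerSeries K) (hF : ∃ k, t ≤ k + s ∧ k ≤ t ∧ PowerSeries.coeff k F ≠ 0) :
    ((Fintype.piFinset fun _ : Fin s => Ω).filter fun x =>
      PowerSeries.coeff t ((revPoly (tupleMultiset x) : PowerSeries K) * F) = 0).card ≤
      s * Ω.card ^ (s - 1) := by
  induction s generalizing F with
  | zero =>
    obtain ⟨k, h1, h2, h3⟩ := hF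
    obtain rfl : k = t := by omega
    rw [Nat.zero_mul, Nat.le_zero, Finset.card_eq_zero, Finset.filter_eq_empty_iff]
    intro x _
    simpa [tupleMultiset, revPoly] using h3
  | succ s ih =>
    obtain ⟨b, rfl⟩ : ∃ b, t = b + (s + 1) := ⟨t - (s + 1), by omega⟩
    -- The only possible bad first coordinate: if (1 - cX)`F` vanishes in degrees b + 1, …, b + s +
    -- 1, the coefficients of `F` from degree b on are geometric of ratio c.
    set c₀ := PowerSeries.coeff (b + 1) F / PowerSeries.coeff b F
    rw [Finset.card_eq_sum_card_fiberwise (f := fun x => x 0) (t := Ω)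
      (fun x hx => by
        simp only [Finset.coe_filter, Set.mem_ofPred_eq, Fintype.mem_piFinset] at hx
        exact hx.1 0)]
    have hfib : ∀ c ∈ Ω, (((Fintype.piFinset fun _ : Fin (s + 1) => Ω).filter fun x =>
        PowerSeries.coeff (b + (s + 1)) ((revPoly (tupleMultiset x) : PowerSeries K) * F) =
          0).filter fun x => x 0 = c).card ≤
        (if c = c₀ then Ω.card ^ s else 0) + s * Ω.card ^ (s - 1) := by
      intro c hc
      set F' : PowerSeries K := (1 - PowerSeries.C c * PowerSeries.X) * F with hF'
      have hinj : (((Fintype.piFinset fun _ : Fin (s + 1) => Ω).filter fun x =>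
          PowerSeries.coeff (b + (s + 1)) ((revPoly (tupleMultiset x) : PowerSeries K) * F) =
          0).filter fun x => x 0 = c).card ≤
          ((Fintype.piFinset fun _ : Fin s => Ω).filter fun x =>
            PowerSeries.coeff (b + (s + 1)) ((revPoly (tupleMultiset x) : PowerSeries K) * F') =
              0).card := by
        refine Finset.card_le_card_of_injOn Fin.tail (fun x hx => ?_) ?_
        · simp only [Finset.mem_filter, Finset.coe_filter, Set.mem_ofPred_eq,
            Fintype.mem_piFinset] at hx ⊢
          refine ⟨fun i => hx.1.1 _, ?_⟩
          have e : tupleMultiset x = c ::ₘ tupleMultiset (Fin.tail x) := by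
            rw [tupleMultiset, tupleMultiset, Fin.univ_val_map, Fin.univ_val_map, List.ofFn_succ,
              hx.2]
            rfl
          rw [← hx.1.2, e, revPoly_cons, hF']
          congr 1
          simp
          ring
        · intro x hx y hy e
          simp only [Finset.coe_filter, Set.mem_ofPred_eq, Finset.mem_filter] at hx hy
          rw [← Fin.cons_self_tail x, ← Fin.cons_self_tail y, e, hx.2, hy.2]
      refine hinj.trans ?_
      have hcoef : ∀ k, PowerSeries.coeff (k + 1) F' =
          PowerSeries.coeff (k + 1) F - c * PowerSeries.coeff k F := by
        intro k
        rw [hF', sub_mul, one_mul, map_sub, mul_assoc, PowerSeries.coeff_C_mul,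
          PowerSeries.coeff_succ_X_mul]
      by_cases hbad : ∃ k, b + (s + 1) ≤ k + s ∧ k ≤ b + (s + 1) ∧ PowerSeries.coeff k F' ≠ 0
      · exact (ih (by omega) F' hbad).trans (Nat.le_add_left _ _)
      · push Not at hbad
        have hrec : ∀ k, b ≤ k → k < b + (s + 1) →
            PowerSeries.coeff (k + 1) F = c * PowerSeries.coeff k F := by
          intro k h1 h2
          have := hbad (k + 1) (by omega) (by omega)
          rwa [hcoef, sub_eq_zero] at this
        have hb : PowerSeries.coeff b F ≠ 0 := by
          intro hb
          obtain ⟨k, h1, h2, h3⟩ := hF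
          have : ∀ j, j ≤ s + 1 → PowerSeries.coeff (b + j) F = 0 := by
            intro j
            induction j with
            | zero => intro _; exact hb
            | succ j ihj =>
              intro hj
              rw [← add_assoc, hrec (b + j) (by omega) (by omega), ihj (by omega), mul_zero]
          apply h3
          have := this (k - b) (by omega)
          rwa [Nat.add_sub_cancel' (by omega)] at this
        have hc : c = c₀ := by
          rw [eq_div_iff hb, hrec b le_rfl (by omega)]
        rw [if_pos hc]
        refine (Finset.card_filter_le _ _).trans ?_
        rw [Fintype.card_piFinset_const]
        exact Nat.le_add_right _ _
    refine (Finset.sum_le_sum hfib).trans ?_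
    rw [Finset.sum_add_distrib, Finset.sum_ite_eq', Finset.sum_const, smul_eq_mul,
      Nat.add_sub_cancel, Nat.add_mul, one_mul, add_comm]
    refine add_le_add ?_ (by split_ifs <;> simp)
    cases s with
    | zero => simp
    | succ s => rw [Nat.add_sub_cancel, pow_succ]; apply le_of_eq; ring

lemma card_powerSumVec_sub_eq_zero_le {d s : ℕ} (hsd : s ≤ d)
    (hd : ∀ k : ℕ, 0 < k → k ≤ d → (k : K) ≠ 0) (Ω : Finset K) :
    (((Fintype.piFinset fun _ : Fin s => Ω) ×ˢ (Fintype.piFinset fun _ : Fin s => Ω)).filter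
      fun q => powerSumVec d q.1 - powerSumVec d q.2 = 0).card ≤ s.factorial * Ω.card ^ s := by
  rw [← Fintype.card_piFinset_const Ω s]
  exact card_filter_powerSumVec_sub_le hsd hd _ _ 0 fun q hq _ => (Finset.mem_product.1 hq).1

/-- The inhomogeneous Vinogradov system of degree `d` in `s < d` pairs of variables has
`O(#Ω ^ (s - 1))` solutions in `Ω`. -/
lemma card_powerSumVec_sub_eq_le {d s : ℕ} (hsd : s < d)
    (hd : ∀ k : ℕ, 0 < k → k ≤ d → (k : K) ≠ 0) (Ω : Finset K) {h : Fin d → K} (h0 : h ≠ 0) :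
    (((Fintype.piFinset fun _ : Fin s => Ω) ×ˢ (Fintype.piFinset fun _ : Fin s => Ω)).filter
      fun q => powerSumVec d q.1 - powerSumVec d q.2 = h).card ≤
      s.factorial * (s * Ω.card ^ (s - 1)) := by
  set T := Fintype.piFinset fun _ : Fin s => Ω
  rcases ((T ×ˢ T).filter fun q => powerSumVec d q.1 - powerSumVec d q.2 = h).eq_empty_or_nonempty
    with he | ⟨⟨x₀, y₀⟩, hq⟩
  · simp [he]
  · have h₀ := (Finset.mem_filter.1 hq).2
    have hne : tupleMultiset x₀ ≠ tupleMultiset y₀ := by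
      intro e
      apply h0
      rw [← h₀]
      ext i
      simp only [Pi.sub_apply, Pi.zero_apply, ← multisetPsum_tupleMultiset, e, sub_self]
    obtain ⟨G, ⟨k, hk1, hk2, hk3⟩, hG⟩ := exists_powerSeries_of_psum_sub
      (fun k h1 h2 => hd k h1 (h2.trans hsd)) (card_tupleMultiset x₀) (card_tupleMultiset y₀) hne
    -- With t = s + 1 the window of degrees t - s, …, t is 1, …, s + 1, exactly where `G` has a
    -- nonzero coefficient. Each admissible `x` leaves at most s! choices of `y`.
    refine (card_filter_powerSumVec_sub_le hsd.le hd T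
      (T.filter fun x =>
        PowerSeries.coeff (s + 1) ((revPoly (tupleMultiset x) : PowerSeries K) * G) = 0)
      h fun q hq hqh => ?_).trans (Nat.mul_le_mul_left _
        (card_filter_coeff_revPoly_mul_eq_zero_le Ω (s + 1) s (Nat.le_succ s) G
          ⟨k, by omega, hk2, hk3⟩))
    rw [Finset.mem_filter]
    exact ⟨(Finset.mem_product.1 hq).1, hG _ _ (card_tupleMultiset q.2) fun j h1 h2 =>
      multisetPsum_sub_of_powerSumVec_sub (hqh.trans h₀.symm) j h1 (h2.trans hsd)⟩

end Counting
-- Parseval and smoothed sums over 𝔽_p^d.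
section Fourier

open Finset

variable {p d : ℕ} [Fact p.Prime]

lemma addChar_map_sum {ι A M : Type*} [AddCommMonoid A] [CommMonoid M] (ψ : AddChar A M)
    (s : Finset ι) (f : ι → A) : ψ (∑ i ∈ s, f i) = ∏ i ∈ s, ψ (f i) := by
  classical
  induction s using Finset.induction with
  | empty => simp
  | insert i s hi ih => rw [Finset.sum_insert hi, Finset.prod_insert hi, ψ.map_add_eq_mul, ih]

lemma sum_stdAddChar_dotProduct (h : Fin d → ZMod p) :
    ∑ a : Fin d → ZMod p, ZMod.stdAddChar (a ⬝ᵥ h) = if h = 0 then (p : ℂ) ^ d else 0 := by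
  have h1 : ∀ a : Fin d → ZMod p,
      ZMod.stdAddChar (a ⬝ᵥ h) = ∏ i, ZMod.stdAddChar (a i * h i) := by
    intro a
    rw [dotProduct, addChar_map_sum]
  simp_rw [h1]
  rw [← Fintype.piFinset_univ,
    ← Finset.prod_univ_sum (fun _ : Fin d => (univ : Finset (ZMod p)))
      (fun i x => ZMod.stdAddChar (x * h i))]
  simp_rw [AddChar.sum_mulShift _ (ZMod.isPrimitive_stdAddChar p), ZMod.card]
  split_ifs with h0
  · simp [h0]
  · obtain ⟨i, hi⟩ := Function.ne_iff.1 h0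
    refine Finset.prod_eq_zero (mem_univ i) ?_
    rw [if_neg (by simpa using hi), Nat.cast_zero]

/-- The exponential sum `∑ w(n) e_p(a · P(n))` over `n ∈ T`. -/
noncomputable def vecExpSum {α : Type*} (T : Finset α) (w : α → ℂ) (P : α → Fin d → ZMod p)
    (a : Fin d → ZMod p) : ℂ :=
  ∑ n ∈ T, w n * ZMod.stdAddChar (a ⬝ᵥ P n)

variable {α : Type*} (T : Finset α) (w : α → ℂ) (P : α → Fin d → ZMod p)

lemma norm_vecExpSum_sq (a : Fin d → ZMod p) :
    ((‖vecExpSum T w P a‖ ^ 2 : ℝ) : ℂ) = ∑ q ∈ T ×ˢ T,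
      (w q.1 * (starRingEnd ℂ) (w q.2)) * ZMod.stdAddChar (a ⬝ᵥ (P q.1 - P q.2)) := by
  rw [Complex.ofReal_pow, ← Complex.mul_conj', vecExpSum, map_sum, Finset.sum_mul_sum,
    ← Finset.sum_product']
  refine Finset.sum_congr rfl fun q _ => ?_
  rw [map_mul, ← AddChar.map_neg_eq_conj, dotProduct_sub, sub_eq_add_neg, AddChar.map_add_eq_mul]
  ring

variable {w}

lemma norm_mul_conj_le_one {z z' : ℂ} (h : ‖z‖ ≤ 1) (h' : ‖z'‖ ≤ 1) :
    ‖z * (starRingEnd ℂ) z'‖ ≤ 1 := by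
  rw [norm_mul, RCLike.norm_conj]
  exact mul_le_one₀ h (norm_nonneg _) h'

lemma sum_norm_vecExpSum_sq_le (hw : ∀ n ∈ T, ‖w n‖ ≤ 1) :
    ∑ a, ‖vecExpSum T w P a‖ ^ 2 ≤
      (p : ℝ) ^ d * ((T ×ˢ T).filter fun q => P q.1 - P q.2 = 0).card := by
  have h1 : ((∑ a, ‖vecExpSum T w P a‖ ^ 2 : ℝ) : ℂ) = ∑ q ∈ T ×ˢ T,
      (w q.1 * (starRingEnd ℂ) (w q.2)) * if P q.1 - P q.2 = 0 then (p : ℂ) ^ d else 0 := by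
    rw [Complex.ofReal_sum]
    simp_rw [norm_vecExpSum_sq]
    rw [Finset.sum_comm]
    refine Finset.sum_congr rfl fun q _ => ?_
    rw [← Finset.mul_sum, sum_stdAddChar_dotProduct]
  have h2 : ∑ a, ‖vecExpSum T w P a‖ ^ 2 = ‖((∑ a, ‖vecExpSum T w P a‖ ^ 2 : ℝ) : ℂ)‖ := by
    rw [Complex.norm_real, Real.norm_of_nonneg (Finset.sum_nonneg fun a _ => by positivity)]
  rw [h2, h1, Finset.card_filter, Nat.cast_sum, Finset.mul_sum]
  refine (norm_sum_le _ _).trans (Finset.sum_le_sum fun q hq => ?_)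
  rw [Finset.mem_product] at hq
  have := norm_mul_conj_le_one (hw _ hq.1) (hw _ hq.2)
  rw [norm_mul]
  split_ifs
  · simp only [norm_pow, Complex.norm_natCast, Nat.cast_one, mul_one]
    exact mul_le_of_le_one_left (by positivity) this
  · simp

/-- The Fourier transform of a set. -/
noncomputable def setFourier (U : Finset (Fin d → ZMod p)) (h : Fin d → ZMod p) : ℂ :=
  ∑ u ∈ U, ZMod.stdAddChar (u ⬝ᵥ h)

lemma norm_setFourier_le (U : Finset (Fin d → ZMod p)) (h : Fin d → ZMod p) :
    ‖setFourier U h‖ ≤ U.card := by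
  refine (norm_sum_le _ _).trans ?_
  simp [AddChar.norm_apply]

lemma sum_norm_setFourier_sq_le (U : Finset (Fin d → ZMod p)) :
    ∑ h, ‖setFourier U h‖ ^ 2 ≤ (p : ℝ) ^ d * U.card := by
  have h1 : ∀ h, setFourier U h = vecExpSum U (fun _ => 1) id h := fun h => by
    simp [setFourier, vecExpSum, dotProduct_comm]
  simp_rw [h1]
  refine (sum_norm_vecExpSum_sq_le U id (fun _ _ => by simp)).trans ?_
  gcongr
  refine Finset.card_le_card_of_injOn Prod.fst (fun q hq => ?_) fun q hq q' hq' e => ?_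
  · simp only [coe_filter, mem_product, Set.mem_ofPred_eq] at hq
    exact hq.1.1
  · simp only [coe_filter, mem_product, Set.mem_ofPred_eq, id, sub_eq_zero] at hq hq'
    exact Prod.ext e (by rw [← hq.2, ← hq'.2, e])

/-- Cauchy–Schwarz and Parseval bound the ℓ¹ norm of the transform of the convolution; for the
cutoff of a single set no such bound is available. -/
lemma sum_norm_setFourier_mul_le (U V : Finset (Fin d → ZMod p)) :
    ∑ h, ‖setFourier U h‖ * ‖setFourier V (-h)‖ ≤
      (p : ℝ) ^ d * (Real.sqrt U.card * Real.sqrt V.card) := by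
  refine (Real.sum_mul_le_sqrt_mul_sqrt _ _ _).trans ?_
  have h1 := sum_norm_setFourier_sq_le U
  have h2 : ∑ h, ‖setFourier V (-h)‖ ^ 2 ≤ (p : ℝ) ^ d * V.card := by
    exact (Equiv.sum_comp (Equiv.neg _) fun h => ‖setFourier V h‖ ^ 2).trans_le
      (sum_norm_setFourier_sq_le V)
  refine (mul_le_mul (Real.sqrt_le_sqrt h1) (Real.sqrt_le_sqrt h2) (Real.sqrt_nonneg _)
    (Real.sqrt_nonneg _)).trans (le_of_eq ?_)
  rw [Real.sqrt_mul (by positivity), Real.sqrt_mul (by positivity)]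
  have : Real.sqrt ((p : ℝ) ^ d) * Real.sqrt ((p : ℝ) ^ d) = (p : ℝ) ^ d :=
    Real.mul_self_sqrt (by positivity)
  linear_combination Real.sqrt U.card * Real.sqrt V.card * this

/-- Opening the square and grouping pairs by h = P(q₁) - P(q₂) weights the transforms of `U` and `V`
at h by the number of pairs. `R₀` bounds this number at h = 0, `R₁` elsewhere. -/
lemma sum_sum_norm_vecExpSum_sub_sq_le (hw : ∀ n ∈ T, ‖w n‖ ≤ 1) {R₀ R₁ : ℝ}
    (hR₀ : (((T ×ˢ T).filter fun q => P q.1 - P q.2 = 0).card : ℝ) ≤ R₀) (hR₁0 : 0 ≤ R₁)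
    (hR₁ : ∀ h, h ≠ 0 → (((T ×ˢ T).filter fun q => P q.1 - P q.2 = h).card : ℝ) ≤ R₁)
    (U V : Finset (Fin d → ZMod p)) :
    ∑ v ∈ V, ∑ u ∈ U, ‖vecExpSum T w P (u - v)‖ ^ 2 ≤
      R₀ * (U.card * V.card) +
        R₁ * ((p : ℝ) ^ d * (Real.sqrt U.card * Real.sqrt V.card)) := by
  have h1 : ((∑ v ∈ V, ∑ u ∈ U, ‖vecExpSum T w P (u - v)‖ ^ 2 : ℝ) : ℂ) = ∑ q ∈ T ×ˢ T,
      (w q.1 * (starRingEnd ℂ) (w q.2)) *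
        (setFourier U (P q.1 - P q.2) * setFourier V (-(P q.1 - P q.2))) := by
    simp_rw [Complex.ofReal_sum, norm_vecExpSum_sq]
    rw [← Finset.sum_product', Finset.sum_comm]
    refine Finset.sum_congr rfl fun q _ => ?_
    rw [← Finset.mul_sum, Finset.sum_product, Finset.sum_comm, setFourier, setFourier,
      Finset.sum_mul_sum]
    congr 1
    refine Finset.sum_congr rfl fun u _ => Finset.sum_congr rfl fun v _ => ?_
    rw [← AddChar.map_add_eq_mul, sub_dotProduct, dotProduct_neg, sub_eq_add_neg]
  have h2 : ∑ v ∈ V, ∑ u ∈ U, ‖vecExpSum T w P (u - v)‖ ^ 2 =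
      ‖((∑ v ∈ V, ∑ u ∈ U, ‖vecExpSum T w P (u - v)‖ ^ 2 : ℝ) : ℂ)‖ := by
    rw [Complex.norm_real, Real.norm_of_nonneg
      (Finset.sum_nonneg fun _ _ => Finset.sum_nonneg fun _ _ => by positivity)]
  set F : (Fin d → ZMod p) → ℝ := fun h => ‖setFourier U h‖ * ‖setFourier V (-h)‖ with hF
  have hF0 : ∀ h, 0 ≤ F h := fun h => by positivity
  have h3 : ∑ v ∈ V, ∑ u ∈ U, ‖vecExpSum T w P (u - v)‖ ^ 2 ≤
      ∑ q ∈ T ×ˢ T, F (P q.1 - P q.2) := by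
    rw [h2, h1]
    refine (norm_sum_le _ _).trans (Finset.sum_le_sum fun q hq => ?_)
    rw [Finset.mem_product] at hq
    rw [norm_mul, norm_mul (setFourier _ _)]
    exact mul_le_of_le_one_left (hF0 _) (norm_mul_conj_le_one (hw _ hq.1) (hw _ hq.2))
  have h4 : ∑ q ∈ T ×ˢ T, F (P q.1 - P q.2) =
      ∑ h, (((T ×ˢ T).filter fun q => P q.1 - P q.2 = h).card : ℝ) * F h := by
    rw [← Finset.sum_fiberwise (T ×ˢ T) (fun q => P q.1 - P q.2)]
    refine Finset.sum_congr rfl fun h _ => ?_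
    rw [← nsmul_eq_mul, ← Finset.sum_const]
    refine Finset.sum_congr rfl fun q hq => ?_
    rw [(Finset.mem_filter.1 hq).2]
  have h5 : ∀ h, (((T ×ˢ T).filter fun q => P q.1 - P q.2 = h).card : ℝ) * F h ≤
      (if h = 0 then R₀ * (U.card * V.card) else 0) + R₁ * F h := by
    intro h
    split_ifs with h0
    · subst h0
      have hF1 : F 0 ≤ U.card * V.card :=
        mul_le_mul (norm_setFourier_le _ _) (norm_setFourier_le _ _) (norm_nonneg _)
          (Nat.cast_nonneg _)
      have := mul_le_mul hR₀ hF1 (hF0 0) ((Nat.cast_nonneg _).trans hR₀)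
      have := mul_nonneg hR₁0 (hF0 0)
      linarith
    · rw [zero_add]
      exact mul_le_mul_of_nonneg_right (hR₁ h h0) (hF0 h)
  refine h3.trans (h4.le.trans ((Finset.sum_le_sum fun h _ => h5 h).trans ?_))
  rw [Finset.sum_add_distrib, Finset.sum_ite_eq', if_pos (mem_univ _), ← Finset.mul_sum]
  have := mul_le_mul_of_nonneg_left (sum_norm_setFourier_mul_le U V) hR₁0
  linarith

/-- Every translate of `B` by an element of `V` lies in `U`, and `f` is nonnegative. -/
lemma sum_mul_card_le_sum_sum_sub {G : Type*} [AddCommGroup G] {f : G → ℝ} (hf : ∀ a, 0 ≤ f a)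
    {B U V : Finset G} (h : ∀ a ∈ B, ∀ v ∈ V, a + v ∈ U) :
    V.card * ∑ a ∈ B, f a ≤ ∑ v ∈ V, ∑ u ∈ U, f (u - v) := by
  rw [← nsmul_eq_mul, ← Finset.sum_const]
  refine Finset.sum_le_sum fun v hv => ?_
  have e : ∑ a ∈ B, f a = ∑ u ∈ B.map (addRightEmbedding v), f (u - v) := by simp
  rw [e]
  refine Finset.sum_le_sum_of_subset_of_nonneg (fun u hu => ?_) fun _ _ _ => hf _
  obtain ⟨a, ha, rfl⟩ := Finset.mem_map.1 hu
  exact h a ha v hv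

end Fourier

/-! ### Cubes modulo p. -/

section Cube

/-- Needed for the doubled cube, whose side 2H may exceed p. -/
lemma card_cube_le (p : ℕ) {d : ℕ} (A : Fin d → ℤ) (H : ℕ) : (cube p A H).card ≤ H ^ d := by
  rw [cube, Fintype.card_piFinset]
  refine (Finset.prod_le_prod' (g := fun _ => H) fun i _ => ?_).trans (by simp)
  refine Finset.card_image_le.trans ?_
  simp

lemma card_cube {p d : ℕ} (A : Fin d → ℤ) {H : ℕ} (hH : H ≤ p) : (cube p A H).card = H ^ d := by
  rw [cube, Fintype.card_piFinset]
  refine (Finset.prod_congr (g := fun _ => H) rfl fun i _ => ?_).trans (by simp)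
  rw [Finset.card_image_of_injOn]
  · simp
  · intro x hx y hy e
    simp only [Finset.coe_Icc, Set.mem_Icc] at hx hy
    have h1 := (ZMod.intCast_eq_intCast_iff_dvd_sub x y p).1 e
    have h2 := Int.eq_zero_of_abs_lt_dvd h1 (by rw [abs_lt]; omega)
    omega

lemma add_mem_cube {p d : ℕ} {A : Fin d → ℤ} {H : ℕ} {a v : Fin d → ZMod p}
    (ha : a ∈ cube p A H) (hv : v ∈ cube p (fun _ => 0) H) : a + v ∈ cube p A (2 * H) := by
  simp only [cube, Fintype.mem_piFinset, Finset.mem_image, Finset.mem_Icc] at *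
  intro i
  obtain ⟨x, hx, hx'⟩ := ha i
  obtain ⟨y, hy, hy'⟩ := hv i
  exact ⟨x + y, by push_cast; omega, by rw [Pi.add_apply, ← hx', ← hy']; push_cast; rfl⟩

end Cube
-- Complete and restricted moments of the exponential sums.
section MeanValue

variable {p d : ℕ} [Fact p.Prime]

/-- The residues modulo `p` of `1, …, N`. -/
def residues (p N : ℕ) : Finset (ZMod p) := (Finset.Icc 1 N).image fun n : ℕ => (n : ZMod p)

lemma natCast_injOn_Icc {p N : ℕ} (hN : N ≤ p) :
    Set.InjOn (fun n : ℕ => (n : ZMod p)) (Finset.Icc 1 N) := by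
  intro x hx y hy e
  simp only [Finset.coe_Icc, Set.mem_Icc] at hx hy
  have h1 : (x : ℤ) ≡ y [ZMOD p] := by
    rw [← ZMod.intCast_eq_intCast_iff]
    simpa using e
  have h2 := Int.eq_zero_of_abs_lt_dvd h1.dvd (by rw [abs_lt]; omega)
  omega

lemma card_residues {p N : ℕ} (hN : N ≤ p) : (residues p N).card = N := by
  rw [residues, Finset.card_image_of_injOn (natCast_injOn_Icc hN), Nat.card_Icc, Nat.add_sub_cancel]

lemma polyPhase_eq_dotProduct (a : Fin d → ZMod p) (n : ℕ) :
    polyPhase a n = a ⬝ᵥ momentCurve d (n : ZMod p) := rfl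

lemma exists_ratExpSumWeighted_pow_eq_vecExpSum {N : ℕ} (hN : N ≤ p) {γ : ℕ → ℂ}
    (hγ : ∀ n ∈ Finset.Icc 1 N, ‖γ n‖ ≤ 1) (k : ℕ) :
    ∃ w : (Fin k → ZMod p) → ℂ,
      (∀ x ∈ Fintype.piFinset fun _ : Fin k => residues p N, ‖w x‖ ≤ 1) ∧
      ∀ a : Fin d → ZMod p, ratExpSumWeighted a γ N ^ k =
        vecExpSum (Fintype.piFinset fun _ : Fin k => residues p N) w (powerSumVec d) a := by
  -- Since N ≤ p, reduction is injective on 1, …, N, so the weights descend to residues.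
  set γ' : ZMod p → ℂ := fun x =>
    γ (Function.invFunOn (fun n : ℕ => (n : ZMod p)) (Finset.Icc 1 N) x) with hγ'
  have hcast : ∀ n ∈ Finset.Icc 1 N, γ' (n : ZMod p) = γ n := by
    intro n hn
    have := (natCast_injOn_Icc hN).leftInvOn_invFunOn (Finset.mem_coe.2 hn)
    exact congrArg γ this
  have hγ'1 : ∀ x ∈ residues p N, ‖γ' x‖ ≤ 1 := by
    intro x hx
    obtain ⟨n, hn, rfl⟩ := Finset.mem_image.1 hx
    rw [hcast n hn]
    exact hγ n hn
  refine ⟨fun x => ∏ i, γ' (x i), fun x hx => ?_, fun a => ?_⟩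
  · rw [norm_prod]
    exact Finset.prod_le_one (fun _ _ => norm_nonneg _)
      fun i _ => hγ'1 _ (Fintype.mem_piFinset.1 hx i)
  · have h1 : ratExpSumWeighted a γ N =
        ∑ x ∈ residues p N, γ' x * ZMod.stdAddChar (a ⬝ᵥ momentCurve d x) := by
      rw [residues, Finset.sum_image (natCast_injOn_Icc hN), ratExpSumWeighted]
      refine Finset.sum_congr rfl fun n hn => ?_
      rw [hcast n hn, polyPhase_eq_dotProduct]
    rw [h1, Finset.sum_pow', vecExpSum]
    refine Finset.sum_congr rfl fun x _ => ?_
    rw [Finset.prod_mul_distrib, ← addChar_map_sum, powerSumVec, dotProduct_sum]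

lemma norm_ratExpSumWeighted_le {N : ℕ} {γ : ℕ → ℂ} (hγ : ∀ n ∈ Finset.Icc 1 N, ‖γ n‖ ≤ 1)
    (a : Fin d → ZMod p) : ‖ratExpSumWeighted a γ N‖ ≤ N := by
  refine (norm_sum_le _ _).trans ((Finset.sum_le_sum (g := fun _ => (1 : ℝ)) fun n hn => ?_).trans ?_)
  · rw [norm_mul, AddChar.norm_apply, mul_one]
    exact hγ n hn
  · simp

lemma natCast_zmod_ne_zero_of_lt (hdp : d < p) (k : ℕ) (h0 : 0 < k) (hk : k ≤ d) :
    (k : ZMod p) ≠ 0 := by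
  rw [Ne, ZMod.natCast_eq_zero_iff]
  exact fun h => absurd (Nat.le_of_dvd h0 h) (by omega)

lemma sum_norm_ratExpSumWeighted_pow_le {N k : ℕ} (hdp : d < p) (hN : N ≤ p) (hk : k ≤ d)
    {γ : ℕ → ℂ} (hγ : ∀ n ∈ Finset.Icc 1 N, ‖γ n‖ ≤ 1) :
    ∑ a : Fin d → ZMod p, ‖ratExpSumWeighted a γ N‖ ^ (2 * k) ≤
      (p : ℝ) ^ d * (k.factorial * (N : ℝ) ^ k) := by
  obtain ⟨w, hw, hS⟩ := exists_ratExpSumWeighted_pow_eq_vecExpSum (d := d) hN hγ k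
  have h1 : ∀ a : Fin d → ZMod p, ‖ratExpSumWeighted a γ N‖ ^ (2 * k) =
      ‖vecExpSum (Fintype.piFinset fun _ : Fin k => residues p N) w (powerSumVec d) a‖ ^ 2 := by
    intro a
    rw [← hS, norm_pow, ← pow_mul, mul_comm]
  simp_rw [h1]
  refine (sum_norm_vecExpSum_sq_le _ _ hw).trans ?_
  gcongr
  have := card_powerSumVec_sub_eq_zero_le hk (natCast_zmod_ne_zero_of_lt hdp) (residues p N)
  rw [card_residues hN] at this
  exact_mod_cast this

lemma sum_norm_ratExpSumWeighted_pow_four_mul_le {N s : ℕ} (hdp : d < p) (hN : N ≤ p) (hN0 : 0 < N)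
    {γ : ℕ → ℂ} (hγ : ∀ n ∈ Finset.Icc 1 N, ‖γ n‖ ≤ 1) :
    ∑ a : Fin d → ZMod p, ‖ratExpSumWeighted a γ N‖ ^ (4 * s) ≤
      (p : ℝ) ^ d * (d.factorial *
        ((N : ℝ) ^ (s : ℝ) + (N : ℝ) ^ (2 * (s : ℝ) - (d : ℝ) / 2))) ^ 2 := by
  have hNr : (0 : ℝ) < N := by exact_mod_cast hN0
  have hf : (1 : ℝ) ≤ d.factorial := by exact_mod_cast Nat.factorial_pos d
  rcases le_total (2 * s) d with h | h
  · have h1 := sum_norm_ratExpSumWeighted_pow_le hdp hN h hγ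
    rw [← mul_assoc] at h1
    refine h1.trans ?_
    gcongr
    have h2 : ((2 * s).factorial : ℝ) ≤ (d.factorial : ℝ) ^ 2 :=
      le_trans (by exact_mod_cast Nat.factorial_le h) (le_self_pow₀ hf two_ne_zero)
    rw [mul_pow, mul_comm 2 s, pow_mul]
    rw [mul_comm 2 s] at h2
    refine mul_le_mul h2 ?_ (by positivity) (by positivity)
    refine pow_le_pow_left₀ (by positivity) ?_ 2
    rw [Real.rpow_natCast]
    exact le_add_of_nonneg_right (by positivity)
  · have h1 := sum_norm_ratExpSumWeighted_pow_le hdp hN le_rfl hγ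
    -- Only moments of order up to 2d are diagonal, so for 2s ≥ d the excess factors are bounded
    -- trivially by N; this produces N^(2s - d/2) after a square root.
    have h2 : ∑ a : Fin d → ZMod p, ‖ratExpSumWeighted a γ N‖ ^ (4 * s) ≤
        (N : ℝ) ^ (4 * s - 2 * d) * ∑ a : Fin d → ZMod p, ‖ratExpSumWeighted a γ N‖ ^ (2 * d) := by
      rw [Finset.mul_sum]
      refine Finset.sum_le_sum fun a _ => ?_
      rw [← Nat.sub_add_cancel (show 2 * d ≤ 4 * s by omega), pow_add, Nat.sub_add_cancel (by omega)]
      gcongr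
      exact norm_ratExpSumWeighted_le hγ a
    refine h2.trans ((mul_le_mul_of_nonneg_left h1 (by positivity)).trans ?_)
    have h3 : ((N : ℝ) ^ (2 * (s : ℝ) - (d : ℝ) / 2)) ^ 2 = (N : ℝ) ^ (4 * s - 2 * d) * (N : ℝ) ^ d := by
      rw [← Real.rpow_natCast (_ ^ _), ← Real.rpow_mul hNr.le, ← pow_add,
        ← Real.rpow_natCast (N : ℝ)]
      congr 1
      rw [Nat.cast_add, Nat.cast_sub (by omega)]
      push_cast
      ring
    have h4 : ((N : ℝ) ^ (4 * s - 2 * d) * (N : ℝ) ^ d) ≤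
        ((N : ℝ) ^ (s : ℝ) + (N : ℝ) ^ (2 * (s : ℝ) - (d : ℝ) / 2)) ^ 2 := by
      rw [← h3]
      refine pow_le_pow_left₀ (by positivity) ?_ 2
      exact le_add_of_nonneg_left (by positivity)
    have h5 : (d.factorial : ℝ) ≤ (d.factorial : ℝ) ^ 2 := le_self_pow₀ hf two_ne_zero
    calc (N : ℝ) ^ (4 * s - 2 * d) * ((p : ℝ) ^ d * (d.factorial * (N : ℝ) ^ d))
        = (p : ℝ) ^ d * (d.factorial * ((N : ℝ) ^ (4 * s - 2 * d) * (N : ℝ) ^ d)) := by ring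
      _ ≤ _ := by
        rw [mul_pow]
        gcongr

lemma restrictedMomentWeighted_cube_le_of_parseval {H N s : ℕ} (hdp : d < p) (hH0 : 0 < H)
    (hH : H ≤ p) (hN : N ≤ p) (hN0 : 0 < N) (A : Fin d → ℤ) {γ : ℕ → ℂ}
    (hγ : ∀ n ∈ Finset.Icc 1 N, ‖γ n‖ ≤ 1) :
    restrictedMomentWeighted (2 * s) (cube p A H) γ N ≤
      d.factorial * (((p : ℝ) / H) ^ ((d : ℝ) / 2) *
        ((N : ℝ) ^ (s : ℝ) + (N : ℝ) ^ (2 * (s : ℝ) - (d : ℝ) / 2))) := by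
  have hHr : (0 : ℝ) < H := by exact_mod_cast hH0
  set Y : ℝ := d.factorial * ((N : ℝ) ^ (s : ℝ) + (N : ℝ) ^ (2 * (s : ℝ) - (d : ℝ) / 2)) with hY
  have hY0 : 0 ≤ Y := by positivity
  have h1 : (∑ a ∈ cube p A H, ‖ratExpSumWeighted a γ N‖ ^ (2 * s)) ^ 2 ≤
      (H : ℝ) ^ d * ((p : ℝ) ^ d * Y ^ 2) := by
    refine (sq_sum_le_card_mul_sum_sq).trans ?_
    rw [card_cube A hH]
    push_cast
    gcongr
    refine le_trans ?_ (sum_norm_ratExpSumWeighted_pow_four_mul_le hdp hN hN0 hγ)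
    refine (Finset.sum_le_univ_sum_of_nonneg fun a => by positivity).trans (le_of_eq ?_)
    refine Finset.sum_congr rfl fun a _ => ?_
    rw [← pow_mul]
    congr 1
    ring
  have hX : (((p : ℝ) / H) ^ ((d : ℝ) / 2)) ^ 2 = (p : ℝ) ^ d / (H : ℝ) ^ d := by
    rw [← Real.rpow_natCast (_ ^ _), ← Real.rpow_mul (by positivity), ← div_pow,
      ← Real.rpow_natCast (_ / _)]
    congr 1
    push_cast
    ring
  rw [restrictedMomentWeighted, card_cube A hH]
  have e : (d.factorial : ℝ) * (((p : ℝ) / H) ^ ((d : ℝ) / 2) *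
        ((N : ℝ) ^ (s : ℝ) + (N : ℝ) ^ (2 * (s : ℝ) - (d : ℝ) / 2))) =
      ((p : ℝ) / H) ^ ((d : ℝ) / 2) * Y := by rw [hY]; ring
  rw [e]
  refine (sq_le_sq₀ (by positivity) (by positivity)).1 ?_
  rw [mul_pow, mul_pow, hX]
  push_cast
  refine (mul_le_mul_of_nonneg_left h1 (by positivity)).trans (le_of_eq ?_)
  field_simp

lemma restrictedMomentWeighted_cube_le_of_congruences {H N s : ℕ} (hdp : d < p) (hH0 : 0 < H)
    (hH : H ≤ p) (hN : N ≤ p) (hsd : s < d) (A : Fin d → ℤ) {γ : ℕ → ℂ}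
    (hγ : ∀ n ∈ Finset.Icc 1 N, ‖γ n‖ ≤ 1) :
    restrictedMomentWeighted (2 * s) (cube p A H) γ N ≤
      2 ^ d * s.factorial * (N : ℝ) ^ s +
        2 ^ d * (s.factorial * s) * (((p : ℝ) / H) ^ d * (N : ℝ) ^ (s - 1)) := by
  have hHr : (0 : ℝ) < H := by exact_mod_cast hH0
  obtain ⟨w, hw, hS⟩ := exists_ratExpSumWeighted_pow_eq_vecExpSum (d := d) hN hγ s
  have hf : ∀ a : Fin d → ZMod p, ‖ratExpSumWeighted a γ N‖ ^ (2 * s) =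
      ‖vecExpSum (Fintype.piFinset fun _ : Fin s => residues p N) w (powerSumVec d) a‖ ^ 2 := by
    intro a
    rw [← hS, norm_pow, ← pow_mul, mul_comm]
  have h0 := card_powerSumVec_sub_eq_zero_le hsd.le (natCast_zmod_ne_zero_of_lt hdp) (residues p N)
  have h1 := fun (h : Fin d → ZMod p) (hh : h ≠ 0) =>
    card_powerSumVec_sub_eq_le hsd (natCast_zmod_ne_zero_of_lt hdp) (residues p N) hh
  rw [card_residues hN] at h0 h1
  -- The cube plus `V` lies in `U`, at the cost of a factor 2^d in size.
  set U := cube p A (2 * H)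
  set V := cube p (fun _ : Fin d => 0) H with hV
  have hVc : V.card = H ^ d := card_cube _ hH
  have hUc : (U.card : ℝ) ≤ 2 ^ d * (H : ℝ) ^ d := by
    rw [← mul_pow]
    exact_mod_cast card_cube_le p A (2 * H)
  have h2 := (sum_mul_card_le_sum_sum_sub (B := cube p A H) (U := U) (V := V)
    (f := fun a => ‖vecExpSum (Fintype.piFinset fun _ : Fin s => residues p N) w
      (powerSumVec d) a‖ ^ 2) (fun a => by positivity)
    fun a ha v hv => add_mem_cube ha hv).trans
      (sum_sum_norm_vecExpSum_sub_sq_le (Fintype.piFinset fun _ : Fin s => residues p N)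
        (powerSumVec d) hw (R₀ := s.factorial * (N : ℝ) ^ s)
        (R₁ := s.factorial * (s * (N : ℝ) ^ (s - 1))) (by exact_mod_cast h0) (by positivity)
        (fun h hh => by exact_mod_cast h1 h hh) U V)
  have hsq : Real.sqrt U.card * Real.sqrt V.card ≤ 2 ^ d * (H : ℝ) ^ d := by
    rw [← Real.sqrt_mul (by positivity)]
    refine Real.sqrt_le_iff.2 ⟨by positivity, ?_⟩
    rw [hVc, sq]
    push_cast
    refine mul_le_mul hUc ?_ (by positivity) (by positivity)
    exact le_mul_of_one_le_left (by positivity) (one_le_pow₀ one_le_two)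
  rw [restrictedMomentWeighted, card_cube A hH]
  simp_rw [hf]
  rw [hVc] at h2
  push_cast at h2 ⊢
  set X := ∑ a ∈ cube p A H,
    ‖vecExpSum (Fintype.piFinset fun _ : Fin s => residues p N) w (powerSumVec d) a‖ ^ 2
  have h3 : (H : ℝ) ^ d * X ≤
      s.factorial * (N : ℝ) ^ s * ((2 ^ d * (H : ℝ) ^ d) * (H : ℝ) ^ d) +
        s.factorial * (s * (N : ℝ) ^ (s - 1)) * ((p : ℝ) ^ d * (2 ^ d * (H : ℝ) ^ d)) := by
    refine h2.trans ?_
    rw [hVc] at hsq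
    push_cast at hsq
    gcongr
  have hHd : (0 : ℝ) < (H : ℝ) ^ d := by positivity
  rw [one_div, inv_mul_le_iff₀ hHd]
  refine le_of_mul_le_mul_left (h3.trans (le_of_eq ?_)) hHd
  rw [div_pow]
  field_simp

end MeanValue

/-! ### Combining the bounds. -/

section Main

lemma pow_add_min_le_smallBoxBound {p d s H N : ℕ} (hH0 : 0 < H) (hH : H ≤ p) :
    (N : ℝ) ^ s + min (((p : ℝ) / (H : ℝ)) ^ (d : ℝ) * (N : ℝ) ^ ((s : ℝ) - 1 / 2))
      (((p : ℝ) / (H : ℝ)) ^ ((d : ℝ) / 2) *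
        ((N : ℝ) ^ (s : ℝ) + (N : ℝ) ^ (2 * (s : ℝ) - (d : ℝ) / 2))) ≤ smallBoxBound p d s H N := by
  have hHr : (0 : ℝ) < H := by exact_mod_cast hH0
  have hq : (1 : ℝ) ≤ p / H := by
    rw [le_div_iff₀ hHr, one_mul]
    exact_mod_cast hH
  rw [smallBoxBound]
  refine add_le_add_left (le_min ?_ ?_) _
  · rw [Real.rpow_natCast, ← div_eq_mul_inv]
    exact le_mul_of_one_le_left (by positivity) hq
  · rw [Real.rpow_neg hHr.le, ← div_eq_mul_inv, ← Real.div_rpow (by positivity) hHr.le,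
      Real.rpow_natCast]
    refine le_trans ?_ (le_mul_of_one_le_left (by positivity) (Real.one_le_rpow hq (by norm_num)))
    exact le_add_of_nonneg_right (by positivity)

lemma restrictedMomentWeighted_cube_le {d p H N s : ℕ} [Fact p.Prime] (hH0 : 0 < H) (hH : H ≤ p)
    (hN0 : 0 < N) (hN : N ≤ p) (hs : 0 < s) (hsd : s < d) (A : Fin d → ℤ) {γ : ℕ → ℂ}
    (hγ : ∀ n ∈ Finset.Icc 1 N, ‖γ n‖ ≤ 1) :
    restrictedMomentWeighted (2 * s) (cube p A H) γ N ≤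
      (2 ^ d * (d.factorial * d) + (d : ℝ) ^ (2 * d)) * smallBoxBound p d s H N := by
  have hHr : (0 : ℝ) < H := by exact_mod_cast hH0
  have hN1 : (1 : ℝ) ≤ N := by exact_mod_cast hN0
  have hd1 : (1 : ℝ) ≤ d := by exact_mod_cast (show 1 ≤ d by omega)
  have hB := pow_add_min_le_smallBoxBound (d := d) (s := s) (N := N) hH0 hH
  set T₃ : ℝ := ((p : ℝ) / (H : ℝ)) ^ (d : ℝ) * (N : ℝ) ^ ((s : ℝ) - 1 / 2) with hT₃
  set T₄ : ℝ := ((p : ℝ) / (H : ℝ)) ^ ((d : ℝ) / 2) *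
        ((N : ℝ) ^ (s : ℝ) + (N : ℝ) ^ (2 * (s : ℝ) - (d : ℝ) / 2)) with hT₄
  have hT₃0 : 0 ≤ T₃ := by positivity
  have hT₄0 : 0 ≤ T₄ := by positivity
  have hNs : (1 : ℝ) ≤ (N : ℝ) ^ s := one_le_pow₀ hN1
  have hB0 : 0 ≤ smallBoxBound p d s H N :=
    le_trans (add_nonneg (by positivity) (le_min hT₃0 hT₄0)) hB
  have hfac : (s.factorial : ℝ) ≤ d.factorial := by exact_mod_cast Nat.factorial_le hsd.le
  have hsd' : (s : ℝ) ≤ d := by exact_mod_cast hsd.le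
  rcases lt_or_ge d p with hdp | hdp
  · refine le_trans ?_ (mul_le_mul_of_nonneg_right
      (le_add_of_nonneg_right (by positivity) :
        (2 ^ d * (d.factorial * d) : ℝ) ≤ 2 ^ d * (d.factorial * d) + (d : ℝ) ^ (2 * d)) hB0)
    refine le_trans ?_ (mul_le_mul_of_nonneg_left hB (by positivity))
    rcases le_total T₃ T₄ with h | h
    · rw [min_eq_left h, mul_add]
      refine (restrictedMomentWeighted_cube_le_of_congruences hdp hH0 hH hN hsd A hγ).trans ?_
      -- The congruence count gives exponent s - 1, stronger than the required s - 1/2.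
      have h3 : ((p : ℝ) / H) ^ d * (N : ℝ) ^ (s - 1) ≤ T₃ := by
        rw [hT₃, Real.rpow_natCast]
        gcongr
        rw [← Real.rpow_natCast]
        refine Real.rpow_le_rpow_of_exponent_le hN1 ?_
        rw [Nat.cast_sub hs]
        push_cast
        linarith
      have h4 : (s.factorial : ℝ) ≤ d.factorial * d :=
        hfac.trans (le_mul_of_one_le_right (by positivity) hd1)
      rw [mul_assoc ((2 : ℝ) ^ d), mul_assoc ((2 : ℝ) ^ d) ((d.factorial : ℝ) * d)]
      gcongr
    · rw [min_eq_right h]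
      refine (restrictedMomentWeighted_cube_le_of_parseval hdp hH0 hH hN hN0 A hγ).trans ?_
      refine mul_le_mul ?_ (le_add_of_nonneg_left (by positivity)) hT₄0 (by positivity)
      refine le_trans ?_ (le_mul_of_one_le_left (by positivity) (one_le_pow₀ one_le_two))
      exact le_mul_of_one_le_right (by positivity) hd1
  -- For p ≤ d the trivial bound |S| ≤ N ≤ p ≤ d suffices; this is the source of the summand d^(2d)
  -- in the constant.
  · have h1 : restrictedMomentWeighted (2 * s) (cube p A H) γ N ≤ (d : ℝ) ^ (2 * d) := by
      rw [restrictedMomentWeighted, card_cube A hH, one_div, inv_mul_le_iff₀ (by positivity),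
        ← card_cube A hH, ← nsmul_eq_mul]
      refine Finset.sum_le_card_nsmul _ _ _ fun a _ => ?_
      have h2 : ‖ratExpSumWeighted a γ N‖ ≤ d :=
        (norm_ratExpSumWeighted_le hγ a).trans (by exact_mod_cast hN.trans hdp)
      exact (pow_le_pow_left₀ (norm_nonneg _) h2 _).trans (pow_le_pow_right₀ hd1 (by omega))
    have h2 : 1 ≤ smallBoxBound p d s H N :=
      hNs.trans (le_trans (le_add_of_nonneg_right (le_min hT₃0 hT₄0)) hB)
    refine h1.trans (le_trans ?_ (le_mul_of_one_le_right (by positivity) h2))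
    exact le_add_of_nonneg_left (by positivity)

lemma restrictedMoment_eq_weighted {p d : ℕ} [NeZero p] (k : ℕ) (U : Finset (Fin d → ZMod p))
    (N : ℕ) : restrictedMoment k U N = restrictedMomentWeighted k U (fun _ => 1) N := by
  simp [restrictedMoment, restrictedMomentWeighted, ratExpSum, ratExpSumWeighted]

end Main

theorem theorem1p5 (d : ℕ) :
    ∃ C : ℝ, 0 < C ∧
      ∀ (p : ℕ) [Fact p.Prime] (H N s : ℕ),
        0 < H → H ≤ p → 0 < N → N ≤ p → 0 < s → s < d →
        ∀ A : Fin d → ℤ,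
          restrictedMoment (2 * s) (cube p A H) N ≤ C * smallBoxBound p d s H N ∧
          ∀ γ : ℕ → ℂ, (∀ n ∈ Finset.Icc 1 N, ‖γ n‖ ≤ 1) →
            restrictedMomentWeighted (2 * s) (cube p A H) γ N ≤ C * smallBoxBound p d s H N := by
  rcases Nat.eq_zero_or_pos d with rfl | hd
  · exact ⟨1, one_pos, fun p _ H N s _ _ _ _ _ hs => absurd hs (Nat.not_lt_zero s)⟩
  · refine ⟨2 ^ d * (d.factorial * d) + (d : ℝ) ^ (2 * d), by positivity, ?_⟩
    intro p _ H N s hH0 hH hN0 hN hs hsd A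
    refine ⟨?_, fun γ hγ => restrictedMomentWeighted_cube_le hH0 hH hN0 hN hs hsd A hγ⟩
    rw [restrictedMoment_eq_weighted]
    exact restrictedMomentWeighted_cube_le hH0 hH hN0 hN hs hsd A fun _ _ => by simp
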